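/- Let $t\in[0,1)$ and $p\in(1,\infty)$. Let $L^p(\mathbb T)$ be the complex Lebesgue space of the circle $\mathbb T$ with the norm $\|f\|_p=\big(\frac1{2\pi}\int_{-\pi}^{\pi}|f(e^{i\theta})|^p\,d\theta\big)^{1/p}$, let $\hat f(n)$, $n\in\mathbb Z$, be the Fourier coefficients of $f$, and let $H^p$ be the Hardy space, identified with the space $\{f\in L^p(\mathbb T): \hat f(n)=0 \text{ for all } n<0\}$ of boundary functions. The Bachelis space $N^p$ consists of all sequences $x=(x_n)_{n=0}^\infty\in\mathbb C^{\mathbb N_0}$ for which there is $f\in H^p$ with $|x|\le\hat f$, that is, with $\hat f(n)$ real and $|x_n|\le\hat f(n)$ for all $n\in\mathbb N_0$; it is a Banach space for the norm $$\|x\|_{N^p}:=\inf\{\|f\|_p : f\in H^p,\ |x|\le\hat f\}.$$ Let $\mathcal C_t$ be the generalized Cesàro operator $$\mathcal C_t x:=\Big(\frac{t^n x_0+t^{n-1}x_1+\dots+x_n}{n+1}\Big)_{n=0}^\infty ,\qquad x\in\mathbb C^{\mathbb N_0},$$ with $0^0=1$, and let $\Lambda:=\{1/(n+1):n\in\mathbb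 N_0\}$. Then $\mathcal C_t$ maps $N^p$ into itself, the operator $\mathcal C_t:N^p\to N^p$ is linear and continuous with $\|\mathcal C_t\|_{N^p\to N^p}\le(1-t)^{-1}$, it is compact, and its spectrum is $$\sigma(\mathcal C_t;N^p)=\Lambda\cup\{0\}.$$ Moreover its fine spectra are $$\sigma_{\mathrm p}(\mathcal C_t;N^p)=\Lambda,\qquad \sigma_{\mathrm c}(\mathcal C_t;N^p)=\{0\},\qquad \sigma_{\mathrm r}(\mathcal C_t;N^p)=\emptyset .$$ Here, for a continuous linear operator $T$ on a complex Banach space $X$, $\sigma_{\mathrm p}(T;X)$ is the set of $\lambda\in\mathbb C$ for which $T-\lambda I$ is not injective, $\sigma_{\mathrm c}(T;X)$ the set of $\lambda$ for which $T-\lambda I$ is injective and its range is a proper dense subspace of $X$, and $\sigma_{\mathrm r}(T;X)$ the set of $\lambda$ for which $T-\lambda I$ is injective and its range is not dense in $X$. -/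

import Mathlib

open MeasureTheory AddCircle
open scoped ENNReal ComplexOrder

noncomputable section

namespace Bachelis

/-- The circle `𝕋 = ℝ / 2πℤ`. It carries the normalized Haar measure
`haarAddCircle = dθ / 2π`, so that `‖f‖_p = (1/2π ∫ |f|^p)^(1/p)` in `Lp`. -/
abbrev Torus : Type := AddCircle (2 * Real.pi)

instance fact_two_pi_pos : Fact (0 < 2 * Real.pi) := ⟨Real.two_pi_pos⟩

/-- The complex Lebesgue space `L^p(𝕋)`. -/
abbrev LpTorus (p : ℝ≥0∞) := Lp ℂ p (haarAddCircle : Measure Torus)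

section Coefficients

variable {p : ℝ≥0∞} [hp : Fact (1 ≤ p)]

theorem integrable_coe (f : LpTorus p) :
    Integrable (f : Torus → ℂ) (haarAddCircle : Measure Torus) :=
  (Lp.memLp f).integrable hp.out

theorem fourierCoeff_coe_zero (n : ℤ) :
    fourierCoeff ((0 : LpTorus p) : Torus → ℂ) n = 0 := by
  unfold fourierCoeff
  rw [← integral_zero Torus ℂ (μ := haarAddCircle)]
  apply integral_congr_ae
  filter_upwards [Lp.coeFn_zero ℂ p (haarAddCircle : Measure Torus)] with x hx
  rw [hx, Pi.zero_apply, smul_zero]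

theorem fourierCoeff_coe_add (f g : LpTorus p) (n : ℤ) :
    fourierCoeff ((f + g : LpTorus p) : Torus → ℂ) n
      = fourierCoeff (f : Torus → ℂ) n + fourierCoeff (g : Torus → ℂ) n := by
  have h := fourierCoeff.add (integrable_coe f) (integrable_coe g)
  have h' := congrFun h n
  rw [Pi.add_apply] at h'
  rw [← h']
  unfold fourierCoeff
  apply integral_congr_ae
  filter_upwards [Lp.coeFn_add f g] with x hx
  rw [hx]

theorem fourierCoeff_coe_smul (c : ℂ) (f : LpTorus p) (n : ℤ) :
    fourierCoeff ((c • f : LpTorus p) : Torus → ℂ) n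
      = c * fourierCoeff (f : Torus → ℂ) n := by
  refine Eq.trans ?_ (fourierCoeff.const_mul (f : Torus → ℂ) c n)
  unfold fourierCoeff
  apply integral_congr_ae
  filter_upwards [Lp.coeFn_smul c f] with x hx
  rw [hx]
  rfl

theorem norm_fourierCoeff_le (f : LpTorus p) (n : ℤ) :
    ‖fourierCoeff (f : Torus → ℂ) n‖ ≤ ‖f‖ := by
  have h1 : ‖fourierCoeff (f : Torus → ℂ) n‖
      ≤ ∫ x, ‖(f : Torus → ℂ) x‖ ∂(haarAddCircle : Measure Torus) := by
    unfold fourierCoeff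
    refine (norm_integral_le_integral_norm _).trans (le_of_eq ?_)
    congr 1
    ext x
    rw [norm_smul, fourier_apply, Circle.norm_coe, one_mul]
  refine h1.trans ?_
  rw [integral_norm_eq_lintegral_enorm (integrable_coe f).1, Lp.norm_def]
  refine ENNReal.toReal_mono (Lp.eLpNorm_ne_top f) ?_
  rw [← eLpNorm_one_eq_lintegral_enorm]
  exact eLpNorm_le_eLpNorm_of_exponent_le hp.out (integrable_coe f).1

end Coefficients

/-- The Hardy space `H^p`, identified with its space of boundary functions: all `f ∈ L^p(𝕋)` whose
Fourier coefficients of negative index vanish. -/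
def hardySpace (p : ℝ≥0∞) [Fact (1 ≤ p)] : Submodule ℂ (LpTorus p) where
  carrier := {f | ∀ n : ℤ, n < 0 → fourierCoeff (f : Torus → ℂ) n = 0}
  zero_mem' := fun n _ => fourierCoeff_coe_zero n
  add_mem' := fun {f g} hf hg n hn => by
    rw [fourierCoeff_coe_add, hf n hn, hg n hn, add_zero]
  smul_mem' := fun c f hf n hn => by
    rw [fourierCoeff_coe_smul, hf n hn, mul_zero]

/-- `|x| ≤ f̂` on `ℕ`. The order is that of `ℂ`, so every `f̂ n` is a real number `≥ |x n|`. -/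
def IsMajorant {p : ℝ≥0∞} (x : ℕ → ℂ) (f : LpTorus p) : Prop :=
  ∀ n : ℕ, ((‖x n‖ : ℝ) : ℂ) ≤ fourierCoeff (f : Torus → ℂ) (n : ℤ)

section Majorants

variable {p : ℝ≥0∞} [hp : Fact (1 ≤ p)]

theorem IsMajorant.zero : IsMajorant (p := p) 0 0 := fun n => by
  rw [fourierCoeff_coe_zero]; simp

theorem IsMajorant.add {x y : ℕ → ℂ} {f g : LpTorus p} (hf : IsMajorant x f)
    (hg : IsMajorant y g) : IsMajorant (x + y) (f + g) := fun n => by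
  rw [fourierCoeff_coe_add]
  refine le_trans ?_ (add_le_add (hf n) (hg n))
  rw [← Complex.ofReal_add, Complex.real_le_real]
  exact norm_add_le _ _

theorem IsMajorant.smul {x : ℕ → ℂ} {f : LpTorus p} (c : ℂ) (hf : IsMajorant x f) :
    IsMajorant (c • x) (((‖c‖ : ℝ) : ℂ) • f) := fun n => by
  rw [fourierCoeff_coe_smul, Pi.smul_apply, norm_smul, Complex.ofReal_mul]
  exact mul_le_mul_of_nonneg_left (hf n) (by simp)

theorem IsMajorant.norm_apply_le {x : ℕ → ℂ} {f : LpTorus p} (hf : IsMajorant x f) (n : ℕ) :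
    ‖x n‖ ≤ ‖f‖ := by
  have h := (Complex.le_def.1 (hf n)).1
  rw [Complex.ofReal_re] at h
  exact (h.trans (Complex.re_le_norm _)).trans (norm_fourierCoeff_le f n)

end Majorants

/-- The sequences `x ∈ ℂ^ℕ` such that `|x| ≤ f̂` for some `f ∈ H^p`. -/
def bachelisSubmodule (p : ℝ≥0∞) [Fact (1 ≤ p)] : Submodule ℂ (ℕ → ℂ) where
  carrier := {x | ∃ f ∈ hardySpace p, IsMajorant x f}
  zero_mem' := ⟨0, (hardySpace p).zero_mem, IsMajorant.zero⟩
  add_mem' := by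
    rintro x y ⟨f, hf, hxf⟩ ⟨g, hg, hyg⟩
    exact ⟨f + g, (hardySpace p).add_mem hf hg, hxf.add hyg⟩
  smul_mem' := by
    rintro c x ⟨f, hf, hxf⟩
    exact ⟨_, (hardySpace p).smul_mem _ hf, hxf.smul c⟩

/-- The Bachelis space `N^p`. It is a type of its own and not the coerced submodule, because the
latter already carries the topology of coordinatewise convergence. -/
def BachelisSpace (p : ℝ≥0∞) [Fact (1 ≤ p)] : Type := bachelisSubmodule p

namespace BachelisSpace

variable {p : ℝ≥0∞} [hp : Fact (1 ≤ p)]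

instance : AddCommGroup (BachelisSpace p) := inferInstanceAs (AddCommGroup (bachelisSubmodule p))

instance : Module ℂ (BachelisSpace p) := inferInstanceAs (Module ℂ (bachelisSubmodule p))

/-- The inclusion `N^p ⊆ ℂ^ℕ`. -/
def toSeq : BachelisSpace p →ₗ[ℂ] (ℕ → ℂ) := (bachelisSubmodule p).subtype

theorem toSeq_injective : Function.Injective (toSeq : BachelisSpace p → ℕ → ℂ) :=
  Subtype.val_injective

theorem exists_majorant (x : BachelisSpace p) : ∃ f ∈ hardySpace p, IsMajorant (toSeq x) f :=
  x.2

/-- The norm `‖x‖ = inf {‖f‖_p : |x| ≤ f̂, f ∈ H^p}`. -/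
instance : Norm (BachelisSpace p) where
  norm x := sInf {r : ℝ | ∃ f ∈ hardySpace p, IsMajorant (toSeq x) f ∧ r = ‖f‖}

theorem norm_def (x : BachelisSpace p) :
    ‖x‖ = sInf {r : ℝ | ∃ f ∈ hardySpace p, IsMajorant (toSeq x) f ∧ r = ‖f‖} := rfl

theorem norm_le_of_majorant {x : BachelisSpace p} {f : LpTorus p} (hf : f ∈ hardySpace p)
    (hx : IsMajorant (toSeq x) f) : ‖x‖ ≤ ‖f‖ := by
  refine csInf_le ⟨0, ?_⟩ ⟨f, hf, hx, rfl⟩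
  rintro r ⟨g, -, -, rfl⟩
  exact norm_nonneg g

theorem le_norm {x : BachelisSpace p} {a : ℝ}
    (h : ∀ f ∈ hardySpace p, IsMajorant (toSeq x) f → a ≤ ‖f‖) : a ≤ ‖x‖ := by
  obtain ⟨f, hf, hx⟩ := exists_majorant x
  refine le_csInf ⟨_, f, hf, hx, rfl⟩ ?_
  rintro r ⟨g, hg, hxg, rfl⟩
  exact h g hg hxg

theorem norm_apply_le (x : BachelisSpace p) (n : ℕ) : ‖toSeq x n‖ ≤ ‖x‖ :=
  le_norm fun _ _ hx => hx.norm_apply_le n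

theorem norm_smul_le_aux (c : ℂ) (x : BachelisSpace p) : ‖c • x‖ ≤ ‖c‖ * ‖x‖ := by
  rcases eq_or_ne c 0 with rfl | hc
  · have : ‖(0 : ℂ) • x‖ ≤ ‖(0 : LpTorus p)‖ := by
      apply norm_le_of_majorant (hardySpace p).zero_mem
      rw [zero_smul, map_zero]
      exact IsMajorant.zero
    simpa using this
  · have hc' : 0 < ‖c‖ := norm_pos_iff.2 hc
    rw [mul_comm, ← div_le_iff₀ hc']
    refine le_norm fun f hf hx => ?_
    rw [div_le_iff₀ hc', mul_comm]
    have h := norm_le_of_majorant (x := c • x)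
      ((hardySpace p).smul_mem ((‖c‖ : ℝ) : ℂ) hf) (by rw [map_smul]; exact hx.smul c)
    rwa [norm_smul ((‖c‖ : ℝ) : ℂ) f, Complex.norm_real, norm_norm] at h

theorem norm_core : NormedSpace.Core ℂ (BachelisSpace p) where
  norm_nonneg x := le_norm fun f _ _ => norm_nonneg f
  norm_smul c x := by
    refine le_antisymm (norm_smul_le_aux c x) ?_
    rcases eq_or_ne c 0 with rfl | hc
    · rw [norm_zero, zero_mul]
      exact le_norm fun f _ _ => norm_nonneg f
    · have h := norm_smul_le_aux c⁻¹ (c • x)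
      rw [inv_smul_smul₀ hc, norm_inv] at h
      rwa [← le_inv_mul_iff₀ (norm_pos_iff.2 hc)]
  norm_triangle x y := by
    rw [← sub_le_iff_le_add]
    refine le_norm fun g hg hy => ?_
    rw [sub_le_iff_le_add, ← sub_le_iff_le_add']
    refine le_norm fun f hf hx => ?_
    rw [sub_le_iff_le_add']
    refine (norm_le_of_majorant ((hardySpace p).add_mem hg hf) ?_).trans (norm_add_le g f)
    rw [map_add]
    exact hy.add hx
  norm_eq_zero_iff x := by
    constructor
    · intro h
      apply toSeq_injective
      ext n
      have := norm_apply_le x n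
      rw [h] at this
      simpa using this
    · rintro rfl
      refine le_antisymm ?_ (le_norm fun f _ _ => norm_nonneg f)
      have := norm_le_of_majorant (x := (0 : BachelisSpace p)) (hardySpace p).zero_mem
        (by rw [map_zero]; exact IsMajorant.zero)
      simpa using this

instance : NormedAddCommGroup (BachelisSpace p) := NormedAddCommGroup.ofCore norm_core

instance : NormedSpace ℂ (BachelisSpace p) := NormedSpace.ofCore norm_core

theorem exists_majorant_lt (x : BachelisSpace p) {e : ℝ} (he : 0 < e) :
    ∃ f ∈ hardySpace p, IsMajorant (toSeq x) f ∧ ‖f‖ < ‖x‖ + e := by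
  by_contra! h
  have := le_norm h
  linarith

/-- `N^p` is a Banach space. -/
instance : CompleteSpace (BachelisSpace p) := by
  refine NormedAddCommGroup.completeSpace_of_summable_imp_tendsto fun u hu => ?_
  have hgeo : ∀ k : ℕ, (0 : ℝ) < (1 / 2) ^ k := fun k => by positivity
  choose f hfH hfu hfn using fun k => exists_majorant_lt (u k) (hgeo k)
  have hf : Summable f := Summable.of_norm_bounded (hu.add summable_geometric_two)
    fun k => (hfn k).le
  let coeff : ℤ → LpTorus p →L[ℂ] ℂ := fun n =>
    LinearMap.mkContinuous
      { toFun := fun g => fourierCoeff (g : Torus → ℂ) n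
        map_add' := fun g h => fourierCoeff_coe_add g h n
        map_smul' := fun c g => fourierCoeff_coe_smul c g n } 1
      (fun g => by rw [one_mul]; exact norm_fourierCoeff_le g n)
  have hcoeff : ∀ n (g : LpTorus p), coeff n g = fourierCoeff (g : Torus → ℂ) n := fun _ _ => rfl
  have hn : ∀ n : ℕ, Summable fun k => ‖toSeq (u k) n‖ := fun n =>
    Summable.of_nonneg_of_le (fun k => norm_nonneg _) (fun k => norm_apply_le (u k) n) hu
  have htail : ∀ N, Summable fun k => f (k + N) := fun N => (summable_nat_add_iff N).2 hf
  have htailH : ∀ N, ∑' k, f (k + N) ∈ hardySpace p := fun N n hneg => by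
    rw [← hcoeff, (coeff n).map_tsum (htail N)]
    simp_rw [hcoeff]
    rw [tsum_congr (fun k => hfH (k + N) n hneg), tsum_zero]
  have htailM : ∀ N, IsMajorant (fun n => ∑' k, toSeq (u (k + N)) n) (∑' k, f (k + N)) :=
    fun N n => by
      have hs : Summable fun k => ‖toSeq (u (k + N)) n‖ := (summable_nat_add_iff N).2 (hn n)
      rw [← hcoeff, (coeff n).map_tsum (htail N)]
      refine le_trans (Complex.real_le_real.2 (norm_tsum_le_tsum_norm hs)) ?_
      rw [Complex.ofReal_tsum]
      exact Summable.tsum_le_tsum (fun k => hfu (k + N) n)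
        (Complex.hasSum_ofReal.2 hs.hasSum).summable
        ((htail N).map _ (coeff n).continuous)
  let a : BachelisSpace p := ⟨fun n => ∑' k, toSeq (u (k + 0)) n, _, htailH 0, htailM 0⟩
  refine ⟨a, ?_⟩
  rw [tendsto_iff_norm_sub_tendsto_zero]
  have h0 : Filter.Tendsto (fun N => ‖∑' k, f (k + N)‖) Filter.atTop (nhds 0) := by
    simpa using (tendsto_sum_nat_add f).norm
  refine squeeze_zero (fun N => norm_nonneg _) (fun N => ?_) h0
  rw [norm_sub_rev]
  refine norm_le_of_majorant (htailH N) ?_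
  convert htailM N using 1
  ext n
  have h1 := (hn n).of_norm.sum_add_tsum_nat_add N
  have h2 : toSeq a n = ∑' k, toSeq (u k) n := rfl
  rw [map_sub, map_sum, Pi.sub_apply, Finset.sum_apply, h2, ← h1]
  ring

end BachelisSpace

/-- The generalized Cesàro operator on `ℂ^ℕ`:
`(C_t x) n = (t^n x 0 + t^(n-1) x 1 + ⋯ + x n) / (n + 1)`, with `0 ^ 0 = 1`. -/
def cesaro (t : ℝ) (x : ℕ → ℂ) : ℕ → ℂ := fun n =>
  (∑ k ∈ Finset.range (n + 1), (t : ℂ) ^ (n - k) * x k) / ((n : ℂ) + 1)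

/-- `Λ = {1 / (n + 1) : n ∈ ℕ}`. -/
def Lam : Set ℂ := Set.range fun n : ℕ => 1 / ((n : ℂ) + 1)

section FineSpectra

variable {X : Type*} [NormedAddCommGroup X] [NormedSpace ℂ X]

/-- The `l` for which `T - l` is not injective. -/
def pointSpectrum (T : X →L[ℂ] X) : Set ℂ :=
  {l | ¬ Function.Injective (T - l • ContinuousLinearMap.id ℂ X)}

/-- The `l` for which `T - l` is injective with a proper dense range. -/
def continuousSpectrum (T : X →L[ℂ] X) : Set ℂ :=
  {l | Function.Injective (T - l • ContinuousLinearMap.id ℂ X) ∧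
    Set.range (T - l • ContinuousLinearMap.id ℂ X) ≠ Set.univ ∧
    Dense (Set.range (T - l • ContinuousLinearMap.id ℂ X))}

/-- The `l` for which `T - l` is injective with a range that is not dense. -/
def residualSpectrum (T : X →L[ℂ] X) : Set ℂ :=
  {l | Function.Injective (T - l • ContinuousLinearMap.id ℂ X) ∧
    closure (Set.range (T - l • ContinuousLinearMap.id ℂ X)) ≠ Set.univ}

end FineSpectra

end Bachelis

end

/-! The operator factors as `C_t = D (1 - tS)⁻¹`, with `S` the right shift and `D` multiplication by
`1 / (n + 1)`. Multiplying a majorant by `e^{iθ}` shows that `S` is a contraction, so `1 - tS` is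
invertible with inverse of norm at most `(1 - t)⁻¹`. A diagonal operator has norm at most any bound
on its entries, so `D` is a norm limit of finite rank operators. Hence `C_t` is compact
(`isCompactOperator_cesaroCLM`).

The matrix of `C_t` is lower triangular with the distinct diagonal entries `1 / (n + 1)`. The first
nonzero coordinate of an eigenvector forces its eigenvalue into `Lam`, and forward substitution
keeps the `m`-th unit sequence out of the range of `C_t - 1 / (m + 1)`. By the Fredholm alternative
the nonzero spectrum is the point spectrum, so no eigenvector has to be constructed inside `N^p`.

At `0` the operator is injective but not onto. Its range contains all finitely supported sequences,
so density reduces to convergence of truncations in `N^p` (`tendsto_truncate`). There Fejér means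
suffice: if `f` majorizes `x`, then `f` minus its `N`-th mean majorizes the tail of `x` beyond `N`.
-/

noncomputable section

namespace Bachelis

open Filter Topology

/-! ### Fejér means in `L^p(𝕋)` -/

section Fejer

/-- The Fejér kernel `|∑_{j ≤ N} e^{ijs}|² / (N + 1)`. -/
def fejerKernel (N : ℕ) (s : Torus) : ℝ :=
  ‖∑ j ∈ Finset.range (N + 1), fourier (j : ℤ) s‖ ^ 2 / ((N : ℝ) + 1)

/-- The Fourier coefficients of the Fejér kernel. -/
def fejerMultiplier (N : ℕ) (n : ℤ) : ℝ :=
  (((Finset.range (N + 1)).filter fun j : ℕ => 0 ≤ (j : ℤ) + n ∧ (j : ℤ) + n ≤ N).card : ℝ)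
    / ((N : ℝ) + 1)

theorem fejerKernel_nonneg (N : ℕ) (s : Torus) : 0 ≤ fejerKernel N s := by
  unfold fejerKernel; positivity

theorem continuous_fejerKernel (N : ℕ) : Continuous (fejerKernel N) := by
  unfold fejerKernel
  fun_prop

theorem fejerMultiplier_le_one (N : ℕ) (n : ℤ) : fejerMultiplier N n ≤ 1 := by
  unfold fejerMultiplier
  rw [div_le_one (by positivity)]
  have h := Finset.card_filter_le (Finset.range (N + 1))
    fun j : ℕ => 0 ≤ (j : ℤ) + n ∧ (j : ℤ) + n ≤ N
  rw [Finset.card_range] at h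
  exact_mod_cast h

theorem fejerMultiplier_eq_zero {N : ℕ} {n : ℤ} (h : (N : ℤ) < n) : fejerMultiplier N n = 0 := by
  unfold fejerMultiplier
  rw [Finset.filter_false_of_mem, Finset.card_empty, Nat.cast_zero, zero_div]
  intro j _
  lia

theorem fejerMultiplier_zero (N : ℕ) : fejerMultiplier N 0 = 1 := by
  unfold fejerMultiplier
  rw [Finset.filter_true_of_mem, Finset.card_range, Nat.cast_add_one, div_self (by positivity)]
  intro j hj
  rw [Finset.mem_range] at hj
  lia

/-- For either sign of `n`, every `j` with `|n| ≤ j ≤ N - |n|` is counted. The sharp bound has no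
factor `2`, but this one avoids a case split and still tends to `1`. -/
theorem one_sub_le_fejerMultiplier (N : ℕ) (n : ℤ) :
    1 - 2 * |(n : ℝ)| / ((N : ℝ) + 1) ≤ fejerMultiplier N n := by
  have hN : (0 : ℝ) < (N : ℝ) + 1 := by positivity
  unfold fejerMultiplier
  rw [one_sub_div hN.ne', div_le_div_iff_of_pos_right hN]
  have h : Finset.Ico n.natAbs (N + 1 - n.natAbs) ⊆
      (Finset.range (N + 1)).filter fun j : ℕ => 0 ≤ (j : ℤ) + n ∧ (j : ℤ) + n ≤ N := by
    intro j hj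
    rw [Finset.mem_Ico] at hj
    rw [Finset.mem_filter, Finset.mem_range]
    lia
  have h2 := Finset.card_le_card h
  rw [Nat.card_Ico] at h2
  have h3 : N + 1 ≤ 2 * n.natAbs +
      ((Finset.range (N + 1)).filter fun j : ℕ => 0 ≤ (j : ℤ) + n ∧ (j : ℤ) + n ≤ N).card := by
    lia
  have h4 : ((N + 1 : ℕ) : ℝ) ≤ _ := Nat.cast_le.2 h3
  push_cast at h4
  rw [Nat.cast_natAbs, Int.cast_abs] at h4
  linarith

theorem tendsto_fejerMultiplier (n : ℤ) :
    Tendsto (fun N => fejerMultiplier N n) atTop (𝓝 1) := by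
  refine tendsto_of_tendsto_of_tendsto_of_le_of_le ?_ tendsto_const_nhds
    (fun N => one_sub_le_fejerMultiplier N n) (fun N => fejerMultiplier_le_one N n)
  have h := (tendsto_one_div_add_atTop_nhds_zero_nat (𝕜 := ℝ)).const_mul (2 * |(n : ℝ)|)
  simpa [div_eq_mul_inv] using h.const_sub 1

theorem integral_fourier (m : ℤ) :
    ∫ s : Torus, fourier m s ∂haarAddCircle = if m = 0 then 1 else 0 := by
  have h := congrFun (fourierCoeff_fourier (T := 2 * Real.pi) m) 0
  simpa [fourierCoeff, Pi.single_apply, eq_comm] using h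

theorem fejerKernel_mul_fourier (N : ℕ) (n : ℤ) (s : Torus) :
    (fejerKernel N s : ℂ) * fourier n s
      = (∑ j ∈ Finset.range (N + 1), ∑ k ∈ Finset.range (N + 1),
          fourier ((j : ℤ) + n - k) s) / ((N : ℂ) + 1) := by
  unfold fejerKernel
  push_cast
  rw [← Complex.mul_conj', map_sum, Finset.sum_mul_sum, div_mul_eq_mul_div, Finset.sum_mul]
  congr 1
  refine Finset.sum_congr rfl fun j _ => ?_
  rw [Finset.sum_mul]
  refine Finset.sum_congr rfl fun k _ => ?_
  rw [← fourier_neg, ← fourier_add, ← fourier_add]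
  congr 1
  ring_nf

theorem integrable_continuousMap (f : C(Torus, ℂ)) :
    Integrable f (haarAddCircle : Measure Torus) :=
  f.continuous.integrable_of_hasCompactSupport (HasCompactSupport.of_compactSpace _)

theorem integral_fejerKernel_mul_fourier (N : ℕ) (n : ℤ) :
    ∫ s : Torus, (fejerKernel N s : ℂ) * fourier n s ∂haarAddCircle = fejerMultiplier N n := by
  simp_rw [fejerKernel_mul_fourier]
  rw [integral_div, integral_finsetSum _ fun j _ => integrable_finsetSum _ fun k _ =>
    integrable_continuousMap _]
  have h : ∀ j ∈ Finset.range (N + 1), ∫ s : Torus, ∑ k ∈ Finset.range (N + 1),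
      fourier ((j : ℤ) + n - k) s ∂haarAddCircle
        = if 0 ≤ (j : ℤ) + n ∧ (j : ℤ) + n ≤ N then 1 else 0 := by
    intro j _
    rw [integral_finsetSum _ fun k _ => integrable_continuousMap _]
    simp_rw [integral_fourier]
    split_ifs with hj
    -- By orthogonality only `k = j + n` contributes.
    · rw [Finset.sum_eq_single ((j : ℤ) + n).toNat]
      · rw [if_pos (by lia)]
      · intro k _ hk
        rw [if_neg (by lia)]
      · intro hk
        rw [Finset.mem_range] at hk
        lia
    · refine Finset.sum_eq_zero fun k hk => ?_
      rw [Finset.mem_range] at hk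
      rw [if_neg (by lia)]
  rw [Finset.sum_congr rfl h, Finset.sum_boole]
  unfold fejerMultiplier
  push_cast
  rfl

theorem integral_fejerKernel (N : ℕ) :
    ∫ s : Torus, fejerKernel N s ∂haarAddCircle = 1 := by
  have h := integral_fejerKernel_mul_fourier N 0
  simp only [fourier_zero, mul_one, fejerMultiplier_zero] at h
  rw [integral_complex_ofReal] at h
  exact_mod_cast h

variable {p : ℝ≥0∞}

/-- The translate `x ↦ f (s + x)` of `f ∈ L^p(𝕋)`. -/
def translate (s : Torus) (f : LpTorus p) : LpTorus p := DomAddAct.mk s +ᵥ f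

theorem translate_ae_eq (s : Torus) (f : LpTorus p) :
    translate s f =ᵐ[haarAddCircle] fun x => f (s + x) :=
  DomAddAct.vadd_Lp_ae_eq (DomAddAct.mk s) f

theorem norm_translate (s : Torus) (f : LpTorus p) : ‖translate s f‖ = ‖f‖ :=
  DomAddAct.norm_vadd_Lp _ f

theorem translate_add (s : Torus) (f g : LpTorus p) :
    translate s (f + g) = translate s f + translate s g :=
  DomAddAct.vadd_Lp_add _ f g

theorem translate_smul (s : Torus) (c : ℂ) (f : LpTorus p) :
    translate s (c • f) = c • translate s f := by
  rcases f with ⟨⟨_⟩, _⟩; rfl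

theorem fourierCoeff_translate (s : Torus) (f : LpTorus p) (n : ℤ) :
    fourierCoeff (translate s f : Torus → ℂ) n
      = fourier n s * fourierCoeff (f : Torus → ℂ) n := by
  rw [fourierCoeff_congr_ae (translate_ae_eq s f)]
  unfold fourierCoeff
  rw [← integral_const_mul]
  -- Translation invariance of Haar measure, applied to the right-hand integral, leaves a pointwise
  -- identity of integrands.
  rw [← integral_add_left_eq_self (fun x : Torus => fourier n s * (fourier (-n) x • f x)) s]
  refine integral_congr_ae (.of_forall fun x => ?_)
  have h : fourier (-n) x = fourier n s * fourier (-n) (s + x) := by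
    have : fourier (-n) (s + x) = fourier (-n) s * fourier (-n) x := by
      simp [smul_add, fourier_apply, toCircle_add]
    rw [this, ← mul_assoc, ← fourier_add, add_neg_cancel, fourier_zero, one_mul]
  simp only [smul_eq_mul]
  rw [h, mul_assoc]

variable [hp : Fact (1 ≤ p)]

/-- The `n`-th Fourier coefficient as a continuous linear functional on `L^p(𝕋)`. -/
def coeffCLM (n : ℤ) : LpTorus p →L[ℂ] ℂ :=
  LinearMap.mkContinuous
    { toFun := fun g => fourierCoeff (g : Torus → ℂ) n
      map_add' := fun g h => fourierCoeff_coe_add g h n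
      map_smul' := fun c g => fourierCoeff_coe_smul c g n } 1
    (fun g => by rw [one_mul]; exact norm_fourierCoeff_le g n)

theorem coeffCLM_apply (n : ℤ) (f : LpTorus p) :
    coeffCLM n f = fourierCoeff (f : Torus → ℂ) n := rfl

theorem fourierCoeff_fourierLp (k n : ℤ) :
    fourierCoeff (fourierLp (T := 2 * Real.pi) p k : Torus → ℂ) n = if n = k then 1 else 0 := by
  rw [fourierCoeff_congr_ae (coeFn_fourierLp p k), fourierCoeff_fourier, Pi.single_apply]

theorem continuous_translate (htop : p ≠ ∞) (f : LpTorus p) :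
    Continuous fun s : Torus => translate s f := by
  have : Fact (p ≠ ∞) := ⟨htop⟩
  unfold translate
  have : Continuous (DomAddAct.mk : Torus → _) := DomAddAct.continuous_mk
  fun_prop

theorem translate_fourierLp (s : Torus) (k : ℤ) :
    translate s (fourierLp (T := 2 * Real.pi) p k) = (fourier k s) • fourierLp p k := by
  apply Lp.ext
  have h1 := (measurePreserving_add_left haarAddCircle s).quasiMeasurePreserving.ae_eq_comp
    (coeFn_fourierLp (T := 2 * Real.pi) p k)
  filter_upwards [translate_ae_eq s (fourierLp (T := 2 * Real.pi) p k), h1,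
    coeFn_fourierLp (T := 2 * Real.pi) p k,
    Lp.coeFn_smul (fourier k s) (fourierLp (T := 2 * Real.pi) p k)] with x hx hx1 hx2 hx3
  rw [hx, hx3, Pi.smul_apply, hx2]
  refine Eq.trans hx1 ?_
  simp [smul_add, fourier_apply, toCircle_add]

/-- The Fejér mean of `f ∈ L^p(𝕋)`. -/
def fejerMean (N : ℕ) (f : LpTorus p) : LpTorus p :=
  ∫ s : Torus, (fejerKernel N s : ℂ) • translate s f ∂haarAddCircle

theorem integrable_fejerKernel_smul_translate (htop : p ≠ ∞) (N : ℕ) (f : LpTorus p) :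
    Integrable (fun s : Torus => (fejerKernel N s : ℂ) • translate s f) haarAddCircle := by
  have h1 := continuous_translate htop f
  have h2 := Complex.continuous_ofReal.comp (continuous_fejerKernel N)
  exact (h2.smul h1).integrable_of_hasCompactSupport (HasCompactSupport.of_compactSpace _)

/-- The kernel is nonnegative with integral one, and translations are isometries. -/
theorem norm_fejerMean_le (N : ℕ) (f : LpTorus p) : ‖fejerMean N f‖ ≤ ‖f‖ := by
  refine (norm_integral_le_integral_norm _).trans (le_of_eq ?_)
  simp_rw [norm_smul, norm_translate, Complex.norm_real, Real.norm_eq_abs,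
    abs_of_nonneg (fejerKernel_nonneg N _)]
  rw [integral_mul_const, integral_fejerKernel, one_mul]

theorem fejerMean_add (htop : p ≠ ∞) (N : ℕ) (f g : LpTorus p) :
    fejerMean N (f + g) = fejerMean N f + fejerMean N g := by
  unfold fejerMean
  simp_rw [translate_add, smul_add]
  exact integral_add (integrable_fejerKernel_smul_translate htop N f)
    (integrable_fejerKernel_smul_translate htop N g)

theorem fejerMean_smul (N : ℕ) (c : ℂ) (f : LpTorus p) :
    fejerMean N (c • f) = c • fejerMean N f := by
  unfold fejerMean
  simp_rw [translate_smul, smul_comm _ c]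
  exact integral_smul c _

theorem fourierCoeff_fejerMean (htop : p ≠ ∞) (N : ℕ) (f : LpTorus p) (n : ℤ) :
    fourierCoeff (fejerMean N f : Torus → ℂ) n
      = fejerMultiplier N n * fourierCoeff (f : Torus → ℂ) n := by
  rw [← coeffCLM_apply, fejerMean,
    ← (coeffCLM n).integral_comp_comm (integrable_fejerKernel_smul_translate htop N f)]
  simp_rw [map_smul, coeffCLM_apply, fourierCoeff_translate, smul_eq_mul, ← mul_assoc]
  rw [integral_mul_const, integral_fejerKernel_mul_fourier]

theorem fejerMean_fourierLp (N : ℕ) (k : ℤ) :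
    fejerMean N (fourierLp (T := 2 * Real.pi) p k) = (fejerMultiplier N k : ℂ) • fourierLp p k := by
  unfold fejerMean
  simp_rw [translate_fourierLp, smul_smul]
  rw [integral_smul_const, integral_fejerKernel_mul_fourier]

/-- Fejér's theorem in `L^p(𝕋)`, `1 ≤ p < ∞`. -/
theorem tendsto_fejerMean (htop : p ≠ ∞) (f : LpTorus p) :
    Tendsto (fun N => fejerMean N f) atTop (𝓝 f) := by
  have hspan : ∀ g ∈ Submodule.span ℂ (Set.range (fourierLp (T := 2 * Real.pi) p)),
      Tendsto (fun N => fejerMean N g) atTop (𝓝 g) := by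
    intro g hg
    induction hg using Submodule.span_induction with
    | mem g hg =>
      obtain ⟨k, rfl⟩ := hg
      simp_rw [fejerMean_fourierLp]
      have h := ((Complex.continuous_ofReal.tendsto 1).comp
        (tendsto_fejerMultiplier k)).smul_const (fourierLp (T := 2 * Real.pi) p k)
      simpa using h
    | zero =>
      have h : ∀ N, fejerMean N (0 : LpTorus p) = 0 := fun N => by
        simpa using fejerMean_smul N 0 (0 : LpTorus p)
      simp_rw [h]
      exact tendsto_const_nhds
    | add g h _ _ hg hh =>
      simp_rw [fejerMean_add htop]
      exact hg.add hh
    | smul c g _ hg =>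
      simp_rw [fejerMean_smul]
      exact hg.const_smul c
  rw [Metric.tendsto_atTop]
  intro e he
  have hf : f ∈ (Submodule.span ℂ (Set.range
      (fourierLp (T := 2 * Real.pi) p))).topologicalClosure := by
    rw [span_fourierLp_closure_eq_top htop]; trivial
  obtain ⟨g, hg, hfg⟩ := Metric.mem_closure_iff.1 hf (e / 3) (by positivity)
  obtain ⟨M, hM⟩ := Metric.tendsto_atTop.1 (hspan g hg) (e / 3) (by positivity)
  refine ⟨M, fun N hN => ?_⟩
  -- The means are contractions uniformly in `N`, so convergence passes from trigonometric
  -- polynomials to their closure.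
  have h1 : dist (fejerMean N f) (fejerMean N g) ≤ dist f g := by
    have h := norm_fejerMean_le N (f - g)
    have h2 := fejerMean_add htop N (f - g) g
    rw [sub_add_cancel] at h2
    rw [dist_eq_norm, dist_eq_norm, h2, add_sub_cancel_right]
    exact h
  have h2 := hM N hN
  have h3 := dist_triangle4 (fejerMean N f) (fejerMean N g) g f
  rw [dist_comm g f] at h3
  linarith

end Fejer

/-! ### Multiplication by `e^{iθ}` -/

section Shift

variable {p : ℝ≥0∞}

theorem memLp_fourier_one_mul (f : LpTorus p) :
    MemLp (fun x : Torus => fourier 1 x * f x) p haarAddCircle := by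
  refine (Lp.memLp f).congr_norm
    ((fourier 1).continuous.aestronglyMeasurable.mul (Lp.aestronglyMeasurable f))
    (.of_forall fun x => ?_)
  rw [norm_mul, fourier_apply, Circle.norm_coe, one_mul]

/-- The function `e^{iθ} f(θ)`. -/
def mulFourierOne (f : LpTorus p) : LpTorus p := (memLp_fourier_one_mul f).toLp _

theorem norm_mulFourierOne (f : LpTorus p) : ‖mulFourierOne f‖ = ‖f‖ := by
  rw [mulFourierOne, Lp.norm_toLp, Lp.norm_def]
  congr 1
  refine eLpNorm_congr_norm_ae (.of_forall fun x => ?_)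
  rw [norm_mul, fourier_apply, Circle.norm_coe, one_mul]

theorem fourierCoeff_mulFourierOne (f : LpTorus p) (n : ℤ) :
    fourierCoeff (mulFourierOne f : Torus → ℂ) n = fourierCoeff (f : Torus → ℂ) (n - 1) := by
  rw [mulFourierOne, fourierCoeff_congr_ae (memLp_fourier_one_mul f).coeFn_toLp]
  unfold fourierCoeff
  refine integral_congr_ae (.of_forall fun x => ?_)
  simp only [smul_eq_mul]
  rw [← mul_assoc, ← fourier_add]
  congr 3
  ring

end Shift

/-! ### Diagonal operators and the shift on `N^p` -/

theorem IsMajorant.mono {p : ℝ≥0∞} {x y : ℕ → ℂ} {f : LpTorus p} (hf : IsMajorant x f)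
    (h : ∀ n, ‖y n‖ ≤ ‖x n‖) : IsMajorant y f := fun n =>
  (Complex.real_le_real.2 (h n)).trans (hf n)

namespace BachelisSpace

variable {p : ℝ≥0∞} [hp : Fact (1 ≤ p)]

theorem ext {x y : BachelisSpace p} (h : ∀ n, toSeq x n = toSeq y n) : x = y :=
  toSeq_injective (funext h)

theorem isMajorant_mul {m x : ℕ → ℂ} {c : ℝ} {f : LpTorus p} (hm : ∀ n, ‖m n‖ ≤ c)
    (hf : IsMajorant x f) : IsMajorant (fun n => m n * x n) ((c : ℂ) • f) := by
  have hc : 0 ≤ c := (norm_nonneg _).trans (hm 0)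
  have h := hf.smul (c : ℂ)
  rw [Complex.norm_real, Real.norm_of_nonneg hc] at h
  refine h.mono fun n => ?_
  rw [norm_mul, Pi.smul_apply, norm_smul, Complex.norm_real, Real.norm_of_nonneg hc]
  gcongr
  exact hm n

/-- The operator `x ↦ (m n * x n)` for a bounded sequence `m`. -/
def diag (m : ℕ → ℂ) (c : ℝ) (hm : ∀ n, ‖m n‖ ≤ c) : BachelisSpace p →L[ℂ] BachelisSpace p :=
  LinearMap.mkContinuous
    { toFun := fun x => ⟨fun n => m n * toSeq x n, by
        obtain ⟨f, hf, hx⟩ := exists_majorant x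
        exact ⟨_, (hardySpace p).smul_mem (c : ℂ) hf, isMajorant_mul hm hx⟩⟩
      map_add' := fun x y => by
        refine ext fun n => ?_
        change m n * toSeq (x + y) n = m n * toSeq x n + m n * toSeq y n
        rw [map_add, Pi.add_apply, mul_add]
      map_smul' := fun a x => by
        refine ext fun n => ?_
        change m n * toSeq (a • x) n = a * (m n * toSeq x n)
        rw [map_smul, Pi.smul_apply, smul_eq_mul, mul_left_comm] } c
    (fun x => by
      have hc : 0 ≤ c := (norm_nonneg _).trans (hm 0)
      refine le_of_forall_pos_le_add fun e he => ?_
      -- Dividing by `c + 1` keeps the error positive even when `c = 0`.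
      obtain ⟨f, hf, hx, hfx⟩ := exists_majorant_lt x (e := e / (c + 1)) (by positivity)
      refine (norm_le_of_majorant ((hardySpace p).smul_mem (c : ℂ) hf)
        (isMajorant_mul hm hx)).trans ?_
      rw [norm_smul, Complex.norm_real, Real.norm_of_nonneg hc]
      calc c * ‖f‖ ≤ c * (‖x‖ + e / (c + 1)) := by gcongr
        _ = c * ‖x‖ + e * (c / (c + 1)) := by ring
        _ ≤ c * ‖x‖ + e * 1 := by
          gcongr
          rw [div_le_one (by positivity)]
          linarith
        _ = c * ‖x‖ + e := by ring)

theorem toSeq_diag {m : ℕ → ℂ} {c : ℝ} (hm : ∀ n, ‖m n‖ ≤ c) (x : BachelisSpace p) (n : ℕ) :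
    toSeq (diag m c hm x) n = m n * toSeq x n := rfl

theorem norm_diag_le {m : ℕ → ℂ} {c : ℝ} (hm : ∀ n, ‖m n‖ ≤ c) :
    ‖diag (p := p) m c hm‖ ≤ c :=
  LinearMap.mkContinuous_norm_le _ ((norm_nonneg _).trans (hm 0)) _

/-- The sequence `(0, x 0, x 1, …)`. -/
def shiftSeq (x : ℕ → ℂ) : ℕ → ℂ
  | 0 => 0
  | n + 1 => x n

theorem mulFourierOne_mem {f : LpTorus p} (hf : f ∈ hardySpace p) :
    mulFourierOne f ∈ hardySpace p := fun n hn => by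
  rw [fourierCoeff_mulFourierOne, hf _ (by lia)]

theorem isMajorant_shiftSeq {x : ℕ → ℂ} {f : LpTorus p} (hf : f ∈ hardySpace p)
    (hx : IsMajorant x f) : IsMajorant (shiftSeq x) (mulFourierOne f) := fun n => by
  rw [fourierCoeff_mulFourierOne]
  cases n with
  | zero =>
    -- The coefficient at `-1` moves to index `0`; it vanishes because `f ∈ H^p`.
    rw [hf _ (by simp)]
    simp [shiftSeq]
  | succ n => simpa [shiftSeq] using hx n

/-- The right shift. -/
def shift : BachelisSpace p →L[ℂ] BachelisSpace p :=
  LinearMap.mkContinuous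
    { toFun := fun x => ⟨shiftSeq (toSeq x), by
        obtain ⟨f, hf, hx⟩ := exists_majorant x
        exact ⟨_, mulFourierOne_mem hf, isMajorant_shiftSeq hf hx⟩⟩
      map_add' := fun x y => by
        refine ext fun n => ?_
        change shiftSeq (toSeq (x + y)) n = shiftSeq (toSeq x) n + shiftSeq (toSeq y) n
        cases n <;> simp [shiftSeq]
      map_smul' := fun a x => by
        refine ext fun n => ?_
        change shiftSeq (toSeq (a • x)) n = a * shiftSeq (toSeq x) n
        cases n <;> simp [shiftSeq] } 1
    (fun x => by
      rw [one_mul]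
      refine le_norm fun f hf hx => ?_
      rw [← norm_mulFourierOne f]
      exact norm_le_of_majorant (mulFourierOne_mem hf) (isMajorant_shiftSeq hf hx))

theorem toSeq_shift_zero (x : BachelisSpace p) : toSeq (shift x) 0 = 0 := rfl

theorem toSeq_shift_succ (x : BachelisSpace p) (n : ℕ) :
    toSeq (shift x) (n + 1) = toSeq x n := rfl

theorem norm_shift_le : ‖shift (p := p)‖ ≤ 1 := LinearMap.mkContinuous_norm_le _ zero_le_one _

theorem norm_smul_shift_lt {t : ℝ} (ht0 : 0 ≤ t) (ht1 : t < 1) :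
    ‖(t : ℂ) • shift (p := p)‖ < 1 := by
  rw [norm_smul, Complex.norm_real, Real.norm_of_nonneg ht0]
  have := norm_shift_le (p := p)
  nlinarith [norm_nonneg (shift (p := p))]

/-- The unit `1 - t S`, where `S` is the right shift. -/
def oneSubShift (t : ℝ) (ht0 : 0 ≤ t) (ht1 : t < 1) :
    (BachelisSpace p →L[ℂ] BachelisSpace p)ˣ :=
  Units.oneSub ((t : ℂ) • shift) (norm_smul_shift_lt ht0 ht1)

section Inverse

variable {t : ℝ} (ht0 : 0 ≤ t) (ht1 : t < 1)

/-- This is `(1 - tS) y = x` solved for `y`. It yields both the norm bound and, recursively, the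
coordinates, without summing the Neumann series. -/
theorem inv_oneSubShift_apply (x : BachelisSpace p) :
    (oneSubShift t ht0 ht1)⁻¹.1 x = x + (t : ℂ) • shift ((oneSubShift t ht0 ht1)⁻¹.1 x) := by
  have h : (oneSubShift t ht0 ht1).1 ((oneSubShift t ht0 ht1)⁻¹.1 x) = x :=
    DFunLike.congr_fun (oneSubShift (p := p) t ht0 ht1).mul_inv x
  exact sub_eq_iff_eq_add.1 h

theorem norm_inv_oneSubShift_le : ‖(oneSubShift (p := p) t ht0 ht1)⁻¹.1‖ ≤ (1 - t)⁻¹ := by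
  have h1t : 0 < 1 - t := sub_pos.2 ht1
  refine ContinuousLinearMap.opNorm_le_bound _ (by positivity) fun x => ?_
  rw [inv_mul_eq_div, le_div_iff₀ h1t]
  set y := (oneSubShift t ht0 ht1)⁻¹.1 x with hy
  have h1 : ‖y‖ ≤ ‖x‖ + ‖(t : ℂ) • shift y‖ := by
    conv_lhs => rw [hy, inv_oneSubShift_apply]
    exact norm_add_le _ _
  have h2 : ‖shift y‖ ≤ ‖y‖ :=
    (shift.le_of_opNorm_le norm_shift_le y).trans_eq (one_mul _)
  rw [norm_smul, Complex.norm_real, Real.norm_of_nonneg ht0] at h1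
  nlinarith

theorem toSeq_inv_oneSubShift (x : BachelisSpace p) (n : ℕ) :
    toSeq ((oneSubShift t ht0 ht1)⁻¹.1 x) n
      = ∑ k ∈ Finset.range (n + 1), (t : ℂ) ^ (n - k) * toSeq x k := by
  induction n with
  | zero =>
    rw [inv_oneSubShift_apply]
    simp [toSeq_shift_zero]
  | succ n ih =>
    rw [inv_oneSubShift_apply, map_add, map_smul, Pi.add_apply, Pi.smul_apply, toSeq_shift_succ,
      ih, Finset.sum_range_succ _ (n + 1), smul_eq_mul, Finset.mul_sum, add_comm]
    congr 1
    · refine Finset.sum_congr rfl fun k hk => ?_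
      rw [Finset.mem_range] at hk
      rw [← mul_assoc, ← pow_succ', Nat.sub_add_comm (by lia)]
    · simp

end Inverse

theorem norm_one_div_succ (n : ℕ) : ‖1 / ((n : ℂ) + 1)‖ = 1 / ((n : ℝ) + 1) := by
  rw [norm_div, norm_one]
  congr 1
  exact_mod_cast Complex.norm_natCast (n + 1)

theorem norm_one_div_succ_le (n : ℕ) : ‖1 / ((n : ℂ) + 1)‖ ≤ 1 := by
  rw [norm_one_div_succ, div_le_one (by positivity)]
  linarith [n.cast_nonneg (α := ℝ)]

/-- The operator `x ↦ (x n / (n + 1))`. -/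
def divSucc : BachelisSpace p →L[ℂ] BachelisSpace p :=
  diag (fun n => 1 / ((n : ℂ) + 1)) 1 norm_one_div_succ_le

/-- The generalized Cesàro operator on `N^p`. -/
def cesaroCLM (t : ℝ) (ht0 : 0 ≤ t) (ht1 : t < 1) : BachelisSpace p →L[ℂ] BachelisSpace p :=
  divSucc * (oneSubShift t ht0 ht1)⁻¹.1

/-! ### Finite rank operators and compactness -/

/-- The `n`-th coordinate functional. -/
def coord (n : ℕ) : BachelisSpace p →L[ℂ] ℂ :=
  LinearMap.mkContinuous ((LinearMap.proj n).comp toSeq) 1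
    (fun x => by rw [one_mul]; exact norm_apply_le x n)

theorem coord_apply (n : ℕ) (x : BachelisSpace p) : coord n x = toSeq x n := rfl

/-- The `n`-th unit sequence. -/
def single (n : ℕ) : BachelisSpace p :=
  ⟨Pi.single n 1, fourierLp p n, fun k hk => by
    rw [fourierCoeff_fourierLp, if_neg (by lia)], fun k => by
    rw [fourierCoeff_fourierLp, Pi.single_apply]
    split_ifs <;> simp_all⟩

theorem toSeq_single (n k : ℕ) : toSeq (single n : BachelisSpace p) k = if k = n then 1 else 0 :=
  Pi.single_apply n 1 k

theorem isCompactOperator_smulRight (φ : BachelisSpace p →L[ℂ] ℂ) (v : BachelisSpace p) :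
    IsCompactOperator (φ.smulRight v) :=
  (isCompactOperator_id (E := ℂ)).clm_comp ((ContinuousLinearMap.id ℂ ℂ).smulRight v)
    |>.comp_clm φ

/-- The finite rank operator `x ↦ (m 0 * x 0, …, m (N - 1) * x (N - 1), 0, 0, …)`. -/
def finiteDiag (N : ℕ) (m : ℕ → ℂ) : BachelisSpace p →L[ℂ] BachelisSpace p :=
  ∑ n ∈ Finset.range N, (coord n).smulRight (m n • single n)

theorem isCompactOperator_finiteDiag (N : ℕ) (m : ℕ → ℂ) :
    IsCompactOperator (finiteDiag (p := p) N m) :=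
  (compactOperator (RingHom.id ℂ) (BachelisSpace p) (BachelisSpace p)).sum_mem
    fun _ _ => isCompactOperator_smulRight _ _

theorem toSeq_finiteDiag (N : ℕ) (m : ℕ → ℂ) (x : BachelisSpace p) (k : ℕ) :
    toSeq (finiteDiag N m x) k = if k < N then m k * toSeq x k else 0 := by
  rw [finiteDiag, _root_.sum_apply, map_sum, Finset.sum_apply]
  simp only [ContinuousLinearMap.smulRight_apply, map_smul, Pi.smul_apply, toSeq_single,
    coord_apply, smul_eq_mul, mul_ite, mul_one, mul_zero, Finset.sum_ite_eq, Finset.mem_range]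
  split_ifs <;> ring

theorem isCompactOperator_divSucc : IsCompactOperator (divSucc (p := p)) := by
  refine isCompactOperator_of_tendsto (l := atTop) 
    (F := fun N => finiteDiag N fun n => 1 / ((n : ℂ) + 1)) ?_
    (.of_forall fun N => isCompactOperator_finiteDiag N _)
  rw [tendsto_iff_norm_sub_tendsto_zero]
  refine squeeze_zero (fun N => norm_nonneg _) (fun N => ?_)
    (tendsto_one_div_add_atTop_nhds_zero_nat (𝕜 := ℝ))
  -- The error of the finite rank approximation is again diagonal, with entries supported on `n ≥
  -- N`.
  have hm : ∀ n : ℕ, ‖if n < N then (0 : ℂ) else 1 / ((n : ℂ) + 1)‖ ≤ 1 / ((N : ℝ) + 1) := by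
    intro n
    split_ifs with h
    · rw [norm_zero]; positivity
    · rw [norm_one_div_succ]
      have : (N : ℝ) ≤ n := Nat.cast_le.2 (not_lt.1 h)
      gcongr
  have h : divSucc (p := p) - finiteDiag N (fun n => 1 / ((n : ℂ) + 1)) = diag _ _ hm := by
    refine ContinuousLinearMap.ext fun x => ext fun n => ?_
    rw [_root_.sub_apply, map_sub, Pi.sub_apply, toSeq_finiteDiag, divSucc,
      toSeq_diag, toSeq_diag]
    split_ifs <;> ring
  rw [norm_sub_rev, h]
  exact norm_diag_le hm

/-! ### Convergence of truncations in `N^p` -/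

/-- The truncation `(x 0, …, x N, 0, 0, …)`. -/
def truncate (N : ℕ) : BachelisSpace p →L[ℂ] BachelisSpace p :=
  finiteDiag (N + 1) 1

theorem toSeq_truncate (N : ℕ) (x : BachelisSpace p) (n : ℕ) :
    toSeq (truncate N x) n = if n < N + 1 then toSeq x n else 0 := by
  rw [truncate, toSeq_finiteDiag, Pi.one_apply, one_mul]

theorem fejerMean_mem (htop : p ≠ ∞) (N : ℕ) {f : LpTorus p} (hf : f ∈ hardySpace p) :
    fejerMean N f ∈ hardySpace p := fun n hn => by
  rw [fourierCoeff_fejerMean htop, hf n hn, mul_zero]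

/-- The function `f - fejerMean N f` is itself a majorant of the tail. Up to index `N` only
nonnegativity of its coefficients is needed, which holds as the multipliers are at most `1`; beyond
`N` they vanish and the coefficients of `f` remain intact. -/
theorem norm_sub_truncate_le (htop : p ≠ ∞) (N : ℕ) {x : BachelisSpace p} {f : LpTorus p}
    (hf : f ∈ hardySpace p) (hx : IsMajorant (toSeq x) f) :
    ‖x - truncate N x‖ ≤ ‖f - fejerMean N f‖ := by
  refine norm_le_of_majorant ((hardySpace p).sub_mem hf (fejerMean_mem htop N hf)) fun n => ?_
  have h0 : (0 : ℂ) ≤ fourierCoeff (f : Torus → ℂ) n :=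
    le_trans (by simp) (hx n)
  have hc : fourierCoeff ((f - fejerMean N f : LpTorus p) : Torus → ℂ) n
      = ((1 - fejerMultiplier N n : ℝ) : ℂ) * fourierCoeff (f : Torus → ℂ) n := by
    rw [← coeffCLM_apply, map_sub, coeffCLM_apply, coeffCLM_apply, fourierCoeff_fejerMean htop]
    push_cast
    ring
  rw [hc, map_sub, Pi.sub_apply, toSeq_truncate]
  split_ifs with h
  · rw [sub_self, norm_zero, Complex.ofReal_zero]
    refine mul_nonneg ?_ h0
    rw [Complex.zero_le_real]
    exact sub_nonneg.2 (fejerMultiplier_le_one N n)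
  · rw [fejerMultiplier_eq_zero (by lia), sub_zero, sub_zero, Complex.ofReal_one, one_mul]
    exact hx n

theorem tendsto_truncate (htop : p ≠ ∞) (x : BachelisSpace p) :
    Tendsto (fun N => truncate N x) atTop (𝓝 x) := by
  obtain ⟨f, hf, hx⟩ := exists_majorant x
  rw [tendsto_iff_norm_sub_tendsto_zero]
  refine squeeze_zero (fun N => norm_nonneg _) (fun N => ?_)
    (tendsto_iff_norm_sub_tendsto_zero.1 (tendsto_fejerMean htop f))
  rw [norm_sub_rev, norm_sub_rev (fejerMean N f)]
  exact norm_sub_truncate_le htop N hf hx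

/-! ### The Cesàro operator on `N^p` -/

section Cesaro

variable {t : ℝ} (ht0 : 0 ≤ t) (ht1 : t < 1)

theorem toSeq_cesaroCLM (x : BachelisSpace p) :
    toSeq (cesaroCLM t ht0 ht1 x) = cesaro t (toSeq x) := by
  funext n
  rw [cesaroCLM, mul_apply_eq_comp, divSucc, toSeq_diag, toSeq_inv_oneSubShift,
    cesaro, one_div_mul_eq_div]

theorem norm_cesaroCLM_le : ‖cesaroCLM (p := p) t ht0 ht1‖ ≤ (1 - t)⁻¹ := by
  refine (norm_mul_le _ _).trans ?_
  have h1 : ‖divSucc (p := p)‖ ≤ 1 := norm_diag_le _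
  exact (mul_le_of_le_one_left (norm_nonneg _) h1).trans (norm_inv_oneSubShift_le ht0 ht1)

theorem isCompactOperator_cesaroCLM : IsCompactOperator (cesaroCLM (p := p) t ht0 ht1) :=
  isCompactOperator_divSucc.comp_clm _

theorem truncate_mem_range_cesaroCLM (N : ℕ) (x : BachelisSpace p) :
    truncate N x ∈ Set.range (cesaroCLM (p := p) t ht0 ht1) := by
  -- The preimage is `(1 - tS) D⁻¹` of the truncation; the unbounded factors `n + 1` are harmless on
  -- finite support.
  refine ⟨(oneSubShift t ht0 ht1).1 (finiteDiag (N + 1) (fun n => (n : ℂ) + 1) x), ?_⟩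
  rw [cesaroCLM, mul_apply_eq_comp]
  have h := DFunLike.congr_fun (oneSubShift (p := p) t ht0 ht1).inv_mul
    (finiteDiag (N + 1) (fun n => (n : ℂ) + 1) x)
  rw [mul_apply_eq_comp, one_apply_eq_self] at h
  rw [h]
  refine ext fun n => ?_
  rw [divSucc, toSeq_diag, toSeq_finiteDiag, toSeq_truncate]
  split_ifs
  · rw [← mul_assoc, one_div_mul_cancel (Nat.cast_add_one_ne_zero n), one_mul]
  · rw [mul_zero]

theorem denseRange_cesaroCLM (htop : p ≠ ∞) : DenseRange (cesaroCLM (p := p) t ht0 ht1) :=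
  fun x => mem_closure_of_tendsto (tendsto_truncate htop x)
    (.of_forall fun N => truncate_mem_range_cesaroCLM ht0 ht1 N x)

end Cesaro

end BachelisSpace

/-! ### Triangularity on `ℂ^ℕ` -/

theorem cesaro_apply_of_forall_lt {t : ℝ} {x : ℕ → ℂ} {m : ℕ} (h : ∀ n < m, x n = 0) :
    cesaro t x m = 1 / ((m : ℂ) + 1) * x m := by
  rw [cesaro, Finset.sum_range_succ, Finset.sum_eq_zero, Nat.sub_self, pow_zero, one_mul, zero_add,
    one_div_mul_eq_div]
  intro k hk
  rw [h k (Finset.mem_range.1 hk), mul_zero]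

theorem one_div_succ_injective : Function.Injective fun n : ℕ => 1 / ((n : ℂ) + 1) := by
  intro m n h
  simpa using h

theorem zero_notMem_Lam : (0 : ℂ) ∉ Lam := by
  rintro ⟨n, hn⟩
  exact one_div_ne_zero (Nat.cast_add_one_ne_zero n) hn

theorem mem_Lam_of_cesaro_eq {t : ℝ} {x : ℕ → ℂ} {l : ℂ} (hx : x ≠ 0)
    (h : cesaro t x = l • x) : l ∈ Lam := by
  classical
  have hex : ∃ n, x n ≠ 0 := Function.ne_iff.1 hx
  refine ⟨Nat.find hex, ?_⟩
  have h1 := congrFun h (Nat.find hex)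
  rw [cesaro_apply_of_forall_lt fun n hn => not_not.1 (Nat.find_min hex hn), Pi.smul_apply,
    smul_eq_mul] at h1
  exact mul_right_cancel₀ (Nat.find_spec hex) h1

/-- Forward substitution: the diagonal entries before `m` differ from `1 / (m + 1)`, so those
coordinates vanish, and the `m`-th equation becomes `0 = 1`. -/
theorem cesaro_sub_smul_ne_single (t : ℝ) (m : ℕ) (x : ℕ → ℂ) :
    cesaro t x - (1 / ((m : ℂ) + 1)) • x ≠ Pi.single m 1 := by
  intro h
  have hn : ∀ n, cesaro t x n - 1 / ((m : ℂ) + 1) * x n = if n = m then 1 else 0 := fun n => by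
    rw [← Pi.single_apply, ← h]; rfl
  have hx : ∀ n < m, x n = 0 := by
    intro n
    induction n using Nat.strong_induction_on with
    | _ n ih =>
      intro hnm
      have h1 := hn n
      rw [cesaro_apply_of_forall_lt fun k hk => ih k hk (hk.trans hnm), if_neg hnm.ne,
        ← sub_mul] at h1
      refine (mul_eq_zero.1 h1).resolve_left (sub_ne_zero.2 fun h2 => ?_)
      exact hnm.ne (one_div_succ_injective h2)
  have h1 := hn m
  rw [cesaro_apply_of_forall_lt hx, sub_self, if_pos rfl] at h1
  exact zero_ne_one h1

/-! ### Spectra of bounded and compact operators -/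

section Spectra

variable {X : Type*} [NormedAddCommGroup X] [NormedSpace ℂ X]

theorem mem_spectrum_iff_not_bijective [CompleteSpace X] (T : X →L[ℂ] X) (l : ℂ) :
    l ∈ spectrum ℂ T ↔ ¬ Function.Bijective (T - l • ContinuousLinearMap.id ℂ X) := by
  rw [spectrum.mem_iff, ← IsUnit.neg_iff, neg_sub, Algebra.algebraMap_eq_smul_one,
    ContinuousLinearMap.isUnit_iff_bijective]
  rfl

theorem mem_pointSpectrum_iff (T : X →L[ℂ] X) (l : ℂ) :
    l ∈ pointSpectrum T ↔ ∃ x, x ≠ 0 ∧ T x = l • x := by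
  change ¬ _ ↔ _
  rw [injective_iff_map_eq_zero]
  push Not
  simp only [_root_.sub_apply, _root_.smul_apply,
    ContinuousLinearMap.id_apply, sub_eq_zero]
  exact exists_congr fun x => and_comm

/-- The Fredholm alternative for compact operators. -/
theorem mem_pointSpectrum_iff_mem_spectrum [CompleteSpace X] {T : X →L[ℂ] X}
    (hT : IsCompactOperator T) {l : ℂ} (hl : l ≠ 0) :
    l ∈ pointSpectrum T ↔ l ∈ spectrum ℂ T := by
  rw [← hT.hasEigenvalue_iff_mem_spectrum hl, mem_pointSpectrum_iff]
  constructor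
  · rintro ⟨x, hx, h⟩
    exact Module.End.hasEigenvalue_of_hasEigenvector ⟨Module.End.mem_eigenspace_iff.2 h, hx⟩
  · intro h
    obtain ⟨x, hx⟩ := h.exists_hasEigenvector
    exact ⟨x, hx.2, hx.apply_eq_smul⟩

end Spectra

/-! ### Spectrum and fine spectra of `C_t` -/

namespace BachelisSpace

variable {p : ℝ≥0∞} [hp : Fact (1 ≤ p)] {t : ℝ} (ht0 : 0 ≤ t) (ht1 : t < 1)

theorem pointSpectrum_cesaroCLM_subset : pointSpectrum (cesaroCLM (p := p) t ht0 ht1) ⊆ Lam := by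
  intro l hl
  obtain ⟨x, hx, h⟩ := (mem_pointSpectrum_iff _ _).1 hl
  have h1 := congrArg toSeq h
  rw [toSeq_cesaroCLM, map_smul] at h1
  exact mem_Lam_of_cesaro_eq (fun h0 => hx (toSeq_injective (h0.trans (map_zero _).symm))) h1

theorem Lam_subset_spectrum_cesaroCLM : Lam ⊆ spectrum ℂ (cesaroCLM (p := p) t ht0 ht1) := by
  rintro _ ⟨m, rfl⟩
  rw [mem_spectrum_iff_not_bijective]
  intro h
  obtain ⟨x, hx⟩ := h.2 (single m)
  refine cesaro_sub_smul_ne_single t m (toSeq x) ?_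
  rw [← toSeq_cesaroCLM ht0 ht1, ← map_smul, ← map_sub]
  exact congrArg toSeq hx

theorem pointSpectrum_cesaroCLM : pointSpectrum (cesaroCLM (p := p) t ht0 ht1) = Lam := by
  refine (pointSpectrum_cesaroCLM_subset ht0 ht1).antisymm fun l hl => ?_
  exact (mem_pointSpectrum_iff_mem_spectrum (isCompactOperator_cesaroCLM ht0 ht1)
    fun h => zero_notMem_Lam (h ▸ hl)).2 (Lam_subset_spectrum_cesaroCLM ht0 ht1 hl)

/-- The spectrum is closed and contains the null sequence `1 / (n + 1)`. -/
theorem zero_mem_spectrum_cesaroCLM : 0 ∈ spectrum ℂ (cesaroCLM (p := p) t ht0 ht1) :=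
  (spectrum.isClosed _).mem_of_tendsto (tendsto_one_div_add_atTop_nhds_zero_nat (𝕜 := ℂ))
    (.of_forall fun n => Lam_subset_spectrum_cesaroCLM ht0 ht1 ⟨n, rfl⟩)

theorem spectrum_cesaroCLM : spectrum ℂ (cesaroCLM (p := p) t ht0 ht1) = Lam ∪ {0} := by
  refine Set.Subset.antisymm (fun l hl => ?_) (Set.union_subset
    (Lam_subset_spectrum_cesaroCLM (p := p) ht0 ht1)
    (Set.singleton_subset_iff.2 (zero_mem_spectrum_cesaroCLM ht0 ht1)))
  rcases eq_or_ne l 0 with rfl | h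
  · exact Or.inr rfl
  · refine Or.inl (pointSpectrum_cesaroCLM_subset (p := p) ht0 ht1 ?_)
    exact (mem_pointSpectrum_iff_mem_spectrum (isCompactOperator_cesaroCLM (p := p) ht0 ht1) h).2 hl

/-- Such an `l` is a spectral value outside the point spectrum `Lam`. Continuous and residual
spectrum are thus both confined to `0`, where density of the range separates them. -/
theorem eq_zero_of_injective_of_range_ne_univ {l : ℂ}
    (hinj : Function.Injective
      (cesaroCLM (p := p) t ht0 ht1 - l • ContinuousLinearMap.id ℂ (BachelisSpace p)))
    (hran : Set.range (cesaroCLM (p := p) t ht0 ht1 - l • ContinuousLinearMap.id ℂ (BachelisSpace p))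
      ≠ Set.univ) : l = 0 := by
  have h : l ∈ spectrum ℂ (cesaroCLM (p := p) t ht0 ht1) :=
    (mem_spectrum_iff_not_bijective _ _).2 fun hb => hran hb.2.range_eq
  rw [spectrum_cesaroCLM, ← pointSpectrum_cesaroCLM (p := p) ht0 ht1] at h
  exact h.resolve_left fun hl => hl hinj

theorem continuousSpectrum_cesaroCLM (htop : p ≠ ∞) :
    continuousSpectrum (cesaroCLM (p := p) t ht0 ht1) = {0} := by
  refine Set.Subset.antisymm (fun l hl =>
    eq_zero_of_injective_of_range_ne_univ ht0 ht1 hl.1 hl.2.1) ?_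
  rw [Set.singleton_subset_iff]
  have hinj : Function.Injective
      (cesaroCLM (p := p) t ht0 ht1 - (0 : ℂ) • ContinuousLinearMap.id ℂ (BachelisSpace p)) :=
    not_not.1 fun h => zero_notMem_Lam (pointSpectrum_cesaroCLM_subset ht0 ht1 h)
  refine ⟨hinj, fun h => ?_, ?_⟩
  · exact (mem_spectrum_iff_not_bijective _ _).1 (zero_mem_spectrum_cesaroCLM ht0 ht1)
      ⟨hinj, Set.range_eq_univ.1 h⟩
  · rw [zero_smul, sub_zero]
    exact denseRange_cesaroCLM ht0 ht1 htop

theorem residualSpectrum_cesaroCLM (htop : p ≠ ∞) :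
    residualSpectrum (cesaroCLM (p := p) t ht0 ht1) = ∅ := by
  rw [Set.eq_empty_iff_forall_notMem]
  rintro l ⟨hinj, hran⟩
  obtain rfl := eq_zero_of_injective_of_range_ne_univ ht0 ht1 hinj
    fun h => hran (by rw [h, closure_univ])
  rw [zero_smul, sub_zero] at hran
  exact hran (denseRange_cesaroCLM ht0 ht1 htop).closure_range

end BachelisSpace

end Bachelis

end

theorem mainTheorem8 (t : ℝ) (ht0 : 0 ≤ t) (ht1 : t < 1)
    (p : ℝ≥0∞) [Fact (1 ≤ p)] (hp1 : 1 < p) (hp : p < ∞) :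
    ∃ C : Bachelis.BachelisSpace p →L[ℂ] Bachelis.BachelisSpace p,
      (∀ x, Bachelis.BachelisSpace.toSeq (C x)
        = Bachelis.cesaro t (Bachelis.BachelisSpace.toSeq x)) ∧
      ‖C‖ ≤ (1 - t)⁻¹ ∧
      IsCompactOperator C ∧
      spectrum ℂ C = Bachelis.Lam ∪ {0} ∧
      Bachelis.pointSpectrum C = Bachelis.Lam ∧
      Bachelis.continuousSpectrum C = {0} ∧
      Bachelis.residualSpectrum C = ∅ :=
  ⟨Bachelis.BachelisSpace.cesaroCLM t ht0 ht1,
    Bachelis.BachelisSpace.toSeq_cesaroCLM ht0 ht1,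
    Bachelis.BachelisSpace.norm_cesaroCLM_le ht0 ht1,
    Bachelis.BachelisSpace.isCompactOperator_cesaroCLM ht0 ht1,
    Bachelis.BachelisSpace.spectrum_cesaroCLM ht0 ht1,
    Bachelis.BachelisSpace.pointSpectrum_cesaroCLM ht0 ht1,
    Bachelis.BachelisSpace.continuousSpectrum_cesaroCLM ht0 ht1 hp.ne,
    Bachelis.BachelisSpace.residualSpectrum_cesaroCLM ht0 ht1 hp.ne⟩
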